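/- **Setting.** Let $N,M,q\in\mathbb Z_+$, $\nu_1,\dots,\nu_M\in\mathbb Z^N$, and $a_1,\dots,a_M:\mathbb Z^N\to[0,\infty)$, with $a_0=\sum_j a_j$. Let $X$ be the càdlàg continuous-time Markov chain on $\mathbb Z^N$ that waits in state $x$ an exponential time of rate $a_0(x)$ and then jumps by $\nu_j$ with probability $a_j(x)/a_0(x)$. Assume that it is non-explosive from every initial state, and let $P(\tau,x,x')$ be its transition probabilities. A tau leap method is a map $\phi:[0,\infty)\times\mathbb Z^N\times\mathbb Z^N\to[0,1]$ with $\sum_{x'}\phi(\tau,x,x')=1$ for all $\tau\ge 0$ and all $x$, and $\phi(0,x,x')=\delta_{x,x'}$. A mesh on $[0,T]$ is $\Pi=(t_0,\dots,t_n)$ with $0=t_0<\dots<t_n=T$; put $\tau_j=t_j-t_{j-1}$ and $\tau=|\Pi|=\max_j\tau_j$. The tau leap solution $Y_\Pi$ is constant on each $[t_{j-1},t_j)$, and $(Y_\Pi(t_j))_j$ is a Markov chain with transition probabilities $\phi(\tau_j,\cdot,\cdot)$ from $t_{j-1}$ to $t_j$. Superscripts $(i)$ denote derivatives in $\tau\in[0,\infty)$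 (one-sided at $0$). For a norm $|\cdot|$ on $\mathbb R^N$, $r\in\mathbb Z_+$ and $g:\mathbb Z^N\to\mathbb R$ put $$|g|_r=\sum_{x\in\mathbb Z^N}\tfrac12(1+|x|^r)\,|g(x)|\in[0,\infty]\qquad(0^0=1),$$ let $\mathcal M=\{g:\ |g|_r<\infty\ \text{for all } r\in\mathbb Z_+\}$, and for a matrix $\psi$ put $(\psi g)(y)=\sum_x\psi(x,y)g(x)$. **Assumptions.** For one norm $|\cdot|$ on $\mathbb R^N$ there are constants $\lambda_r,H_r,\delta_r,\gamma_r>0$ and integers $s_r\ge 1$ ($r\in\mathbb Z_+$) such that: 1. for some $s^*\in\mathbb Z_+$ and $\alpha>0$, $a_j(x)\le\alpha(|x|^{s^*}+1)$ for all $j$ and $x$; 2. $\sum_{x'}(1+|x'|^r)P(\tau,x,x')\le(1+|x|^r)e^{\lambda_r\tau}$ for all $r$, $\tau>0$ and $x$; 3. each $\tau\mapsto\phi(\tau,x,x')$ is $q+1$ times continuously differentiable on $[0,\infty)$, and $\phi^{(i)}(0,x,x')=P^{(i)}(0,x,x')$ for $i=1,\dots,q$; 4. (and 5.) $\sum_{x'}(1+|x'|^r)|\phi^{(q+1)}(\tau,x,x')|\le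 H_r(|x|^{s_r}+1)e^{\gamma_r\tau}$ for all $r$, $\tau\in[0,\delta_r)$ and $x$ (Assumption 4 is the case $r=0$); 6. $\sum_{x'}(1+|x'|^r)\phi(\tau,x,x')\le(1+|x|^r)e^{\lambda_r\tau}$ for all $r$, $\tau\in[0,\delta_r)$ and $x$. **Theorem (order $q$ convergence in moment variation).** Let $r\in\mathbb Z_+$. (a) The constants $H_r,s_r,\gamma_r$ can be enlarged so that, in addition to the bound in 5, $$\sum_{x'}(1+|x'|^r)|P^{(q+1)}(\tau,x,x')|\le H_r(|x|^{s_r}+1)e^{\gamma_r\tau}\qquad\text{for all }\tau>0\text{ and }x.\tag{$*$}$$ (b) For all $H_r,\gamma_r>0$ and integers $s_r\ge1$ satisfying both the bound in 5 and $(*)$, there is a constant $C_r>0$ such that $$|(\phi(\tau)-P(\tau))g|_r\le C_r\,|g|_{s_r+r}\,\tau^{q+1}e^{\gamma_r\tau}\qquad\text{for all }\tau\in[0,\delta_r),\ g\in\mathcal M.\tag{$**$}$$ (c) Let $H_r,s_r,\gamma_r$ be as in (b), let $C_r>0$ be any constant satisfying $(**)$, and put $\mu_r=\max\{\lambda_r,\lambda_{s_r+r},\gamma_r\}$.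 Then for every $T$, every mesh $\Pi=(t_0,\dots,t_n)$ on $[0,T]$ with $\tau=|\Pi|<\delta_r$, and every probability mass function $p_0\in\mathcal M$, the probability mass functions $p(t)$ of $X(t)$ and $\hat p_\Pi(t)$ of $Y_\Pi(t)$, both started with distribution $p_0$, satisfy for $i=0,1,\dots,n$ $$|\hat p_\Pi(t_i)-p(t_i)|_r\le C_r\,|p_0|_{s_r+r}\,t_i\,e^{\mu_r t_i}\,\tau^q\le C_r\,|p_0|_{s_r+r}\,T\,e^{\mu_r T}\,\tau^q .$$ -/

import Mathlib

open scoped ENNReal Topology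
open MeasureTheory Set Filter

noncomputable section

/-- The state space `ℤ^N`. -/
abbrev LState (N : ℕ) : Type := Fin N → ℤ

/-! ### The chemical process -/

/-- The total propensity `a₀(x) = ∑ⱼ aⱼ(x)`. -/
def totalPropensity {N M : ℕ} (a : Fin M → LState N → ℝ) (x : LState N) : ℝ :=
  ∑ j, a j x

/-- The probability that the process with jump sizes `ν j` and intensities `a j`, started in `x`,
makes exactly `n` jumps during `(0, t]` and is in state `x'` at time `t ≥ 0`.
No jump: the exponential waiting time with rate `a₀(x)` exceeds `t`.
For `n + 1` jumps, decompose according to the time `u` and the channel `j` of the last jump: after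
`n` jumps the process is in `x' - ν j` at time `u`, it jumps at rate `a j (x' - ν j)` to `x'`, and
the waiting time in `x'`, exponential with rate `a₀(x')`, exceeds `t - u`. -/
def jumpProb {N M : ℕ} (ν : Fin M → LState N) (a : Fin M → LState N → ℝ) :
    ℕ → ℝ → LState N → LState N → ℝ≥0∞
  | 0, t, x, x' =>
      if x = x' then ENNReal.ofReal (Real.exp (-(totalPropensity a x * t))) else 0
  | n + 1, t, x, x' =>
      ∫⁻ u in Ioc (0 : ℝ) t, ∑ j : Fin M,
        jumpProb ν a n u x (x' - ν j) * ENNReal.ofReal (a j (x' - ν j)) *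
          ENNReal.ofReal (Real.exp (-(totalPropensity a x' * (t - u))))

/-- The probability of being in `x'` at time `t` after finitely many jumps, as an extended
nonnegative number. -/
def transProbENN {N M : ℕ} (ν : Fin M → LState N) (a : Fin M → LState N → ℝ)
    (t : ℝ) (x x' : LState N) : ℝ≥0∞ :=
  ∑' n : ℕ, jumpProb ν a n t x x'

/-- The process is non-explosive: from every state, it almost surely makes only finitely many jumps
in every finite time interval. -/
def NonExplosive {N M : ℕ} (ν : Fin M → LState N) (a : Fin M → LState N → ℝ) : Prop :=
  ∀ t : ℝ, 0 ≤ t → ∀ x : LState N, ∑' x', transProbENN ν a t x x' = 1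

/-- The transition probabilities `P(t, x, x')` of the chemical process (used for `t ≥ 0`). -/
def transProb {N M : ℕ} (ν : Fin M → LState N) (a : Fin M → LState N → ℝ)
    (t : ℝ) (x x' : LState N) : ℝ :=
  (transProbENN ν a t x x').toReal

/-- `X(t)`, `t ≥ 0`, is the chemical process with stoichiometric vectors `ν`, propensities `a` and
initial distribution `p₀`: a Markov process with transition probabilities `P` and càdlàg paths. -/
structure IsChemicalProcess {N M : ℕ} (ν : Fin M → LState N) (a : Fin M → LState N → ℝ)
    (p₀ : PMF (LState N)) {Ω : Type*} [MeasurableSpace Ω] (ℙ : Measure Ω)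
    (X : ℝ → Ω → LState N) : Prop where
  measurable : ∀ t, 0 ≤ t → Measurable (X t)
  right_continuous : ∀ᵐ ω ∂ℙ, ∀ t, 0 ≤ t → ContinuousWithinAt (fun u => X u ω) (Ici t) t
  left_limits : ∀ᵐ ω ∂ℙ, ∀ t, 0 < t →
    ∃ y, Tendsto (fun u => X u ω) (𝓝[<] t) (𝓝 y)
  markov : ∀ (n : ℕ) (t : Fin (n + 1) → ℝ), t 0 = 0 → StrictMono t →
    ∀ x : Fin (n + 1) → LState N,
      ℙ.real {ω | ∀ i, X (t i) ω = x i} =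
        (p₀ (x 0)).toReal *
          ∏ i : Fin n, transProb ν a (t i.succ - t i.castSucc) (x i.castSucc) (x i.succ)

/-! ### Tau leap methods -/

/-- A tau leap method: `φ τ x` is a probability mass function on the states for every step size
`τ ≥ 0` and every current state `x`, and nothing moves in a step of length `0`. -/
structure IsTauLeapMethod {N : ℕ} (φ : ℝ → LState N → LState N → ℝ) : Prop where
  nonneg : ∀ τ, 0 ≤ τ → ∀ x x', 0 ≤ φ τ x x'
  sum_eq_one : ∀ τ, 0 ≤ τ → ∀ x, HasSum (φ τ x) 1
  zero_step : ∀ x x', φ 0 x x' = if x = x' then 1 else 0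

/-- `0 = t₀ < t₁ < ⋯ < tₙ = T`. -/
def IsMesh {n : ℕ} (T : ℝ) (t : Fin (n + 1) → ℝ) : Prop :=
  t 0 = 0 ∧ StrictMono t ∧ t (Fin.last n) = T

/-- The maximal step size `|Π|` of a mesh. -/
def maxStep {n : ℕ} (t : Fin (n + 1) → ℝ) : ℝ :=
  ⨆ j : Fin n, (t j.succ - t j.castSucc)

/-- `Y` is the tau leap solution for the method `φ` on the mesh `t` with initial
distribution `p₀`: it is constant between mesh points, and its values at the mesh points form a
Markov chain whose transition probabilities over the successive steps are given by `φ`. -/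
structure IsTauLeapSolution {N : ℕ} (φ : ℝ → LState N → LState N → ℝ) (p₀ : PMF (LState N))
    {n : ℕ} (t : Fin (n + 1) → ℝ) {Ω : Type*} [MeasurableSpace Ω] (ℙ : Measure Ω)
    (Y : ℝ → Ω → LState N) : Prop where
  measurable : ∀ u ∈ Icc 0 (t (Fin.last n)), Measurable (Y u)
  piecewise_constant : ∀ᵐ ω ∂ℙ, ∀ j : Fin n, ∀ u ∈ Ico (t j.castSucc) (t j.succ),
    Y u ω = Y (t j.castSucc) ω
  markov : ∀ x : Fin (n + 1) → LState N,
    ℙ.real {ω | ∀ i, Y (t i) ω = x i} =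
      (p₀ (x 0)).toReal *
        ∏ j : Fin n, φ (t j.succ - t j.castSucc) (x j.castSucc) (x j.succ)

/-! ### Moment variation -/

/-- The norm `|x|` of a lattice point, for a norm on `ℝ^N`. -/
def latNorm {N : ℕ} (nrm : Seminorm ℝ (Fin N → ℝ)) (x : LState N) : ℝ :=
  nrm (fun i => (x i : ℝ))

/-- The `r`-th moment variation `|g|_r = ∑ₓ ½ (1 + |x|^r) |g(x)| ≤ ∞`. -/
def momentVariation {N : ℕ} (nrm : Seminorm ℝ (Fin N → ℝ)) (r : ℕ) (g : LState N → ℝ) : ℝ≥0∞ :=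
  ∑' x, ENNReal.ofReal (1 / 2 * (1 + latNorm nrm x ^ r) * |g x|)

/-- Membership in the space `𝓜 = ⋂ᵣ 𝓜ᵣ`. -/
def FiniteMoments {N : ℕ} (nrm : Seminorm ℝ (Fin N → ℝ)) (g : LState N → ℝ) : Prop :=
  ∀ r : ℕ, momentVariation nrm r g < ∞

/-- `(ψ g)(y) = ∑ₓ ψ(x, y) g(x)`. -/
def opApply {N : ℕ} (ψ : LState N → LState N → ℝ) (g : LState N → ℝ) (y : LState N) : ℝ :=
  ∑' x, ψ x y * g x

/-- The class `𝓒ₛ` of functions of polynomial growth of degree `s`. -/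
def PolyGrowth {N : ℕ} (nrm : Seminorm ℝ (Fin N → ℝ)) (s : ℕ) (f : LState N → ℝ) : Prop :=
  ∃ α > 0, ∀ x, |f x| ≤ α * (latNorm nrm x ^ s + 1)

/-! ### The assumptions -/

/-- The `i`-th derivative `ψ^{(i)}(τ, x, x')` in `τ ∈ [0, ∞)`, one-sided at `τ = 0`. -/
def timeDeriv {N : ℕ} (ψ : ℝ → LState N → LState N → ℝ) (i : ℕ) (τ : ℝ) (x x' : LState N) : ℝ :=
  iteratedDerivWithin i (fun u => ψ u x x') (Ici 0) τ

/-- `∑_{x'} (1 + |x'|^r) ψ(τ, x, x') ≤ (1 + |x|^r) e^{ℓ τ}` for all `x` and all `τ ∈ I`. -/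
def MomentGrowthBound {N : ℕ} (nrm : Seminorm ℝ (Fin N → ℝ)) (ψ : ℝ → LState N → LState N → ℝ)
    (r : ℕ) (ℓ : ℝ) (I : Set ℝ) : Prop :=
  ∀ τ ∈ I, ∀ x, ∑' x', ENNReal.ofReal ((1 + latNorm nrm x' ^ r) * ψ τ x x') ≤
    ENNReal.ofReal ((1 + latNorm nrm x ^ r) * Real.exp (ℓ * τ))

/-- Pointwise consistency of order `q` of the method `φ` with the transition probabilities `P`. -/
def PointwiseConsistent {N : ℕ} (φ P : ℝ → LState N → LState N → ℝ) (q : ℕ) : Prop :=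
  ∀ x x', ContDiffOn ℝ ((q + 1 : ℕ) : WithTop ℕ∞) (fun τ => φ τ x x') (Ici 0) ∧
    ∀ i ∈ Finset.Icc 1 q, timeDeriv φ i 0 x x' = timeDeriv P i 0 x x'

/-- `∑_{x'} (1 + |x'|^r) |ψ^{(m)}(τ, x, x')| ≤ H (|x|^s + 1) e^{γ τ}` for all `x`, all `τ ∈ I`. -/
def DerivBound {N : ℕ} (nrm : Seminorm ℝ (Fin N → ℝ)) (ψ : ℝ → LState N → LState N → ℝ)
    (m r : ℕ) (H : ℝ) (s : ℕ) (γ : ℝ) (I : Set ℝ) : Prop :=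
  ∀ τ ∈ I, ∀ x, ∑' x', ENNReal.ofReal ((1 + latNorm nrm x' ^ r) * |timeDeriv ψ m τ x x'|) ≤
    ENNReal.ofReal (H * (latNorm nrm x ^ s + 1) * Real.exp (γ * τ))

/-- Order `q` consistency in the `r`-th moment variation, with constant `C`:
`|(φ(τ) - P(τ)) g|_r ≤ C |g|_{s+r} τ^{q+1} e^{γ τ}` for all `τ ∈ [0, δ)`, `g ∈ 𝓜`. -/
def ConsistentInMoment {N : ℕ} (nrm : Seminorm ℝ (Fin N → ℝ))
    (φ P : ℝ → LState N → LState N → ℝ) (q r : ℕ) (C : ℝ) (s : ℕ) (γ δ : ℝ) : Prop :=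
  ∀ τ ∈ Ico 0 δ, ∀ g, FiniteMoments nrm g →
    momentVariation nrm r (opApply (fun x x' => φ τ x x' - P τ x x') g) ≤
      ENNReal.ofReal C * momentVariation nrm (s + r) g *
        ENNReal.ofReal (τ ^ (q + 1) * Real.exp (γ * τ))

end

/-! ### Transition probabilities: the forward equation and smoothness in time -/

section TransitionProbabilities

variable {N M : ℕ} {ν : Fin M → LState N} {a : Fin M → LState N → ℝ}

/-! The argument is consistency plus stability in the weighted norm. Over a step of length `h` the
error splits as `p̂_{i+1} - p_{i+1} = φ(h)(p̂_i - p_i) + (φ(h) - P(h)) p_i`. Moment growth of `φ`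
multiplies the old error by at most `e^{λ_r h}`. The new local error is `O(h^{q+1})` with a factor
`|p_i|_{s+r}`, which moment growth of `P` bounds by `e^{λ_{s+r} t_i} |p₀|_{s+r}`. Summing the local
errors loses one power of the step size (`momentVariation_error_le`).

The local estimate is a Taylor expansion at time 0 in each entry: `φ - P` has vanishing derivatives
up to order `q`, so each entry is controlled by an integral of `|φ^{(q+1)}| + |P^{(q+1)}|`. By
Tonelli the weighted sum over target states passes under the integral, where the derivative bounds
apply (`weightedSum_sub_le`).

The bound on `P^{(q+1)}` comes from the forward equation. The last-jump decomposition gives an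
integral equation for `P`, hence `P' = A P` entrywise with the master operator `A`. Since `A`
couples each state to finitely many others, this iterates to `P^{(k)} = A^k P`
(`iteratedDerivWithin_transProb`). With polynomial propensities, each application of `A` costs
finitely many moments, and all moments of `P` are controlled (`derivBound_transProb`).

The recursions for `p_i` and `p̂_i` are extracted from the finite-dimensional laws of the two chains
(`measureReal_succ_of_chain`). -/

theorem ofReal_exp_split (c t u : ℝ) :
    ENNReal.ofReal (Real.exp (-(c * (t - u)))) =
      ENNReal.ofReal (Real.exp (-(c * t))) * ENNReal.ofReal (Real.exp (c * u)) := by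
  rw [← ENNReal.ofReal_mul (Real.exp_pos _).le, ← Real.exp_add]
  congr 2
  ring

/-- With the factor depending on `t` pulled out, `t` enters the integral only as its upper limit;
the integral is then monotone in `t`, which gives measurability. -/
theorem jumpProb_succ (n : ℕ) (t : ℝ) (x y : LState N) :
    jumpProb ν a (n + 1) t x y =
      ENNReal.ofReal (Real.exp (-(totalPropensity a y * t))) *
        ∫⁻ u in Ioc (0 : ℝ) t, ∑ j : Fin M, jumpProb ν a n u x (y - ν j) *
          (ENNReal.ofReal (a j (y - ν j)) *
            ENNReal.ofReal (Real.exp (totalPropensity a y * u))) := by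
  rw [jumpProb, ← lintegral_const_mul' _ _ ENNReal.ofReal_ne_top]
  refine lintegral_congr fun u => ?_
  rw [Finset.mul_sum]
  refine Finset.sum_congr rfl fun j _ => ?_
  rw [ofReal_exp_split]
  ring

theorem measurable_jumpProb (n : ℕ) (x y : LState N) :
    Measurable fun t => jumpProb ν a n t x y := by
  cases n with
  | zero =>
    simp only [jumpProb]
    split_ifs
    · fun_prop
    · exact measurable_const
  | succ n =>
    simp only [jumpProb_succ]
    refine Measurable.mul (by fun_prop) (Monotone.measurable fun s t hst => ?_)
    exact lintegral_mono_set (Ioc_subset_Ioc_right hst)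

theorem measurable_transProbENN (x y : LState N) :
    Measurable fun t => transProbENN ν a t x y :=
  Measurable.tsum fun n => measurable_jumpProb n x y

/-- The forward equation in integrated form. -/
theorem transProbENN_eq (t : ℝ) (x y : LState N) :
    transProbENN ν a t x y =
      ENNReal.ofReal (Real.exp (-(totalPropensity a y * t))) * ((if x = y then 1 else 0) +
        ∫⁻ u in Ioc (0 : ℝ) t, ∑ j : Fin M, transProbENN ν a u x (y - ν j) *
          (ENNReal.ofReal (a j (y - ν j)) *
            ENNReal.ofReal (Real.exp (totalPropensity a y * u)))) := by
  rw [transProbENN, tsum_eq_zero_add' ENNReal.summable, mul_add]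
  congr 1
  · rw [jumpProb]
    split_ifs with h
    · rw [h, mul_one]
    · rw [mul_zero]
  · simp only [jumpProb_succ]
    rw [ENNReal.tsum_mul_left, ← lintegral_tsum]
    · congr 1
      refine lintegral_congr fun u => ?_
      rw [Summable.tsum_finsetSum fun _ _ => ENNReal.summable]
      refine Finset.sum_congr rfl fun j _ => ?_
      rw [ENNReal.tsum_mul_right, transProbENN]
    · intro n
      refine (Finset.measurable_fun_sum _ fun j _ => ?_).aemeasurable
      exact (measurable_jumpProb n x _).mul (by fun_prop)

theorem transProbENN_le_one (hne : NonExplosive ν a) {t : ℝ} (ht : 0 ≤ t) (x y : LState N) :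
    transProbENN ν a t x y ≤ 1 :=
  (ENNReal.le_tsum y).trans (hne t ht x).le

theorem transProb_nonneg (t : ℝ) (x y : LState N) : 0 ≤ transProb ν a t x y :=
  ENNReal.toReal_nonneg

theorem transProb_le_one (hne : NonExplosive ν a) {t : ℝ} (ht : 0 ≤ t) (x y : LState N) :
    transProb ν a t x y ≤ 1 :=
  ENNReal.toReal_le_of_le_ofReal zero_le_one (by simpa using transProbENN_le_one hne ht x y)

theorem ofReal_transProb (hne : NonExplosive ν a) {t : ℝ} (ht : 0 ≤ t) (x y : LState N) :
    ENNReal.ofReal (transProb ν a t x y) = transProbENN ν a t x y :=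
  ENNReal.ofReal_toReal ((transProbENN_le_one hne ht x y).trans_lt ENNReal.one_lt_top).ne

theorem transProb_zero (x y : LState N) :
    transProb ν a 0 x y = if x = y then 1 else 0 := by
  rw [transProb, transProbENN_eq]
  split_ifs <;> simp

/-- The integrand in the forward equation. -/
noncomputable def inflow (ν : Fin M → LState N) (a : Fin M → LState N → ℝ) (x y : LState N) (u : ℝ) : ℝ :=
  ∑ j : Fin M, transProb ν a u x (y - ν j) *
    (a j (y - ν j) * Real.exp (totalPropensity a y * u))

theorem inflow_nonneg (ha : ∀ j x, 0 ≤ a j x) (x y : LState N) (u : ℝ) :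
    0 ≤ inflow ν a x y u :=
  Finset.sum_nonneg fun _ _ => mul_nonneg (transProb_nonneg _ _ _)
    (mul_nonneg (ha _ _) (Real.exp_pos _).le)

theorem measurable_inflow (x y : LState N) : Measurable (inflow ν a x y) := by
  refine Finset.measurable_fun_sum _ fun j _ => ?_
  exact (measurable_transProbENN x _).ennreal_toReal.mul (by fun_prop)

theorem integrableOn_inflow (ha : ∀ j x, 0 ≤ a j x) (hne : NonExplosive ν a) (x y : LState N)
    (t : ℝ) : IntegrableOn (inflow ν a x y) (Ioc 0 t) := by
  have hb : IntegrableOn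
      (fun u => ∑ j : Fin M, a j (y - ν j) * Real.exp (totalPropensity a y * u)) (Ioc 0 t) := by
    refine Continuous.integrableOn_Ioc ?_
    fun_prop
  refine hb.mono' (measurable_inflow x y).aestronglyMeasurable ?_
  refine (ae_restrict_iff' measurableSet_Ioc).2 (ae_of_all _ fun u hu => ?_)
  rw [Real.norm_of_nonneg (inflow_nonneg ha x y u)]
  refine Finset.sum_le_sum fun _ _ => mul_le_of_le_one_left ?_ (transProb_le_one hne hu.1.le _ _)
  exact mul_nonneg (ha _ _) (Real.exp_pos _).le

theorem transProb_eq (ha : ∀ j x, 0 ≤ a j x) (hne : NonExplosive ν a) {t : ℝ} (ht : 0 ≤ t)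
    (x y : LState N) :
    transProb ν a t x y = Real.exp (-(totalPropensity a y * t)) *
      ((if x = y then 1 else 0) + ∫ u in (0 : ℝ)..t, inflow ν a x y u) := by
  have key : ∫⁻ u in Ioc (0 : ℝ) t, ∑ j : Fin M, transProbENN ν a u x (y - ν j) *
      (ENNReal.ofReal (a j (y - ν j)) * ENNReal.ofReal (Real.exp (totalPropensity a y * u))) =
      ENNReal.ofReal (∫ u in (0 : ℝ)..t, inflow ν a x y u) := by
    rw [intervalIntegral.integral_of_le ht, ofReal_integral_eq_lintegral_ofReal
      (integrableOn_inflow ha hne x y t) (ae_of_all _ (inflow_nonneg ha x y))]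
    refine setLIntegral_congr_fun measurableSet_Ioc fun u hu => ?_
    simp only [inflow]
    rw [ENNReal.ofReal_sum_of_nonneg]
    · refine Finset.sum_congr rfl fun j _ => ?_
      rw [ENNReal.ofReal_mul (transProb_nonneg _ _ _), ofReal_transProb hne hu.1.le,
        ENNReal.ofReal_mul (ha _ _)]
    · exact fun j _ => mul_nonneg (transProb_nonneg _ _ _)
        (mul_nonneg (ha _ _) (Real.exp_pos _).le)
  have hi : 0 ≤ ∫ u in (0 : ℝ)..t, inflow ν a x y u :=
    intervalIntegral.integral_nonneg ht fun u _ => inflow_nonneg ha x y u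
  rw [transProb, transProbENN_eq, key, ENNReal.toReal_mul,
    ENNReal.toReal_ofReal (Real.exp_pos _).le, ENNReal.toReal_add (by split_ifs <;> simp)
    ENNReal.ofReal_ne_top, ENNReal.toReal_ofReal hi]
  split_ifs <;> simp

/-- A bootstrap: the inflow is at first only known to be integrable on bounded intervals, so its
primitive, and hence `P`, is continuous. This makes the inflow itself continuous, as differentiating
the primitive requires. -/
theorem continuousOn_transProb (ha : ∀ j x, 0 ≤ a j x) (hne : NonExplosive ν a)
    (x y : LState N) : ContinuousOn (fun t => transProb ν a t x y) (Ici 0) := by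
  have h : ContinuousOn (fun t => ∫ u in (0 : ℝ)..t, inflow ν a x y u) (Ici 0) := by
    intro t (ht : 0 ≤ t)
    have hc := intervalIntegral.continuousOn_primitive_interval
      (f := inflow ν a x y) (μ := volume) (a := 0) (b := t + 1) (by
        rw [uIcc_of_le (add_nonneg ht zero_le_one), integrableOn_Icc_iff_integrableOn_Ioc]
        exact integrableOn_inflow ha hne x y _)
    rw [uIcc_of_le (add_nonneg ht zero_le_one)] at hc
    refine (hc t ⟨ht, by linarith⟩).mono_of_mem_nhdsWithin ?_
    exact inter_mem_nhdsWithin _ (Iic_mem_nhds (by linarith))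
  refine ContinuousOn.congr (f := fun t => Real.exp (-(totalPropensity a y * t)) *
      ((if x = y then 1 else 0) + ∫ u in (0 : ℝ)..t, inflow ν a x y u)) ?_
    fun t ht => transProb_eq ha hne ht x y
  exact ContinuousOn.mul (by fun_prop) (continuousOn_const.add h)

/-- The right-hand side of the forward (master) equation. -/
noncomputable def masterOp (ν : Fin M → LState N) (a : Fin M → LState N → ℝ) (g : LState N → ℝ)
    (y : LState N) : ℝ :=
  ∑ j : Fin M, a j (y - ν j) * g (y - ν j) - totalPropensity a y * g y

/-- The forward (master) equation. -/
theorem hasDerivWithinAt_transProb (ha : ∀ j x, 0 ≤ a j x) (hne : NonExplosive ν a) {t : ℝ}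
    (ht : t ∈ Ici (0 : ℝ)) (x y : LState N) :
    HasDerivWithinAt (fun t => transProb ν a t x y) (masterOp ν a (transProb ν a t x) y)
      (Ici 0) t := by
  have hc : ContinuousOn (inflow ν a x y) (Ici 0) := by
    refine continuousOn_finsetSum _ fun j _ => ?_
    exact (continuousOn_transProb ha hne x _).mul (by fun_prop)
  have hI : HasDerivWithinAt (fun t => ∫ u in (0 : ℝ)..t, inflow ν a x y u)
      (inflow ν a x y t) (Ici 0) t := by
    -- Freezing the integrand at its value at 0 for negative times makes it continuous on the whole
    -- line, so the two-sided fundamental theorem of calculus also covers the endpoint 0.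
    have hg : Continuous fun u => inflow ν a x y (max u 0) :=
      hc.comp_continuous (by fun_prop) fun u => le_max_right u 0
    have h1 := (hg.integral_hasStrictDerivAt 0 t).hasDerivAt.hasDerivWithinAt (s := Ici 0)
    rw [max_eq_left (mem_Ici.1 ht)] at h1
    refine h1.congr_of_mem (fun s hs => ?_) ht
    refine intervalIntegral.integral_congr fun u hu => ?_
    rw [uIcc_of_le (mem_Ici.1 hs)] at hu
    simp only [max_eq_left hu.1]
  have hE : HasDerivWithinAt (fun t => Real.exp (-(totalPropensity a y * t)))
      (Real.exp (-(totalPropensity a y * t)) * (-(totalPropensity a y * 1))) (Ici 0) t :=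
    ((hasDerivWithinAt_id t (Ici 0)).const_mul _).neg.exp
  have h := (hE.mul (hI.const_add (if x = y then 1 else 0))).congr_of_mem
    (f₁ := fun t => transProb ν a t x y) (fun s hs => transProb_eq ha hne hs x y) ht
  refine h.congr_deriv ?_
  rw [masterOp, transProb_eq ha hne ht x y]
  simp only [inflow]
  rw [Finset.mul_sum]
  have : ∀ j, Real.exp (-(totalPropensity a y * t)) * (transProb ν a t x (y - ν j) *
      (a j (y - ν j) * Real.exp (totalPropensity a y * t))) =
      a j (y - ν j) * transProb ν a t x (y - ν j) := by
    intro j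
    rw [Real.exp_neg]
    field_simp
  simp only [this]
  ring

theorem hasDerivWithinAt_masterOp {f : ℝ → LState N → ℝ} {f' : LState N → ℝ} {s : Set ℝ} {t : ℝ}
    (h : ∀ y, HasDerivWithinAt (fun u => f u y) (f' y) s t) (y : LState N) :
    HasDerivWithinAt (fun u => masterOp ν a (f u) y) (masterOp ν a f' y) s t := by
  unfold masterOp
  exact (HasDerivWithinAt.fun_sum fun j _ => (h _).const_mul _).sub ((h y).const_mul _)

/-- Each state has inflow from at most `M` states, so the master operator is a finite sum in every
entry and commutes with time differentiation without any interchange of limits. -/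
theorem hasDerivWithinAt_iterate_masterOp (ha : ∀ j x, 0 ≤ a j x) (hne : NonExplosive ν a)
    (k : ℕ) {t : ℝ} (ht : t ∈ Ici (0 : ℝ)) (x y : LState N) :
    HasDerivWithinAt (fun t => (masterOp ν a)^[k] (transProb ν a t x) y)
      ((masterOp ν a)^[k + 1] (transProb ν a t x) y) (Ici 0) t := by
  induction k generalizing y with
  | zero => exact hasDerivWithinAt_transProb ha hne ht x y
  | succ k ih =>
    rw [Function.iterate_succ_apply']
    simp only [Function.iterate_succ_apply' _ k]
    exact hasDerivWithinAt_masterOp (by simpa only [Function.iterate_succ_apply'] using ih) y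

theorem iteratedDerivWithin_transProb (ha : ∀ j x, 0 ≤ a j x) (hne : NonExplosive ν a)
    (k : ℕ) {t : ℝ} (ht : t ∈ Ici (0 : ℝ)) (x y : LState N) :
    iteratedDerivWithin k (fun t => transProb ν a t x y) (Ici 0) t =
      (masterOp ν a)^[k] (transProb ν a t x) y := by
  induction k generalizing t with
  | zero => simp
  | succ k ih =>
    rw [iteratedDerivWithin_succ, derivWithin_congr (fun s hs => ih hs) (ih ht)]
    exact (hasDerivWithinAt_iterate_masterOp ha hne k ht x y).derivWithin
      (uniqueDiffOn_Ici 0 t ht)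

theorem contDiffOn_transProb (ha : ∀ j x, 0 ≤ a j x) (hne : NonExplosive ν a) (k : ℕ)
    (x y : LState N) :
    ContDiffOn ℝ (k : WithTop ℕ∞) (fun t => transProb ν a t x y) (Ici 0) := by
  refine contDiffOn_of_differentiableOn_deriv (n := (k : ℕ∞)) fun m _ t ht => ?_
  exact ((hasDerivWithinAt_iterate_masterOp ha hne m ht x y).congr_of_mem
    (fun s hs => iteratedDerivWithin_transProb ha hne m hs x y) ht).differentiableWithinAt

end TransitionProbabilities

/-! ### Weighted sums: the master operator costs finitely many moments -/

section Moments

variable {N M : ℕ}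

theorem latNorm_nonneg (nrm : Seminorm ℝ (Fin N → ℝ)) (x : LState N) : 0 ≤ latNorm nrm x :=
  apply_nonneg nrm _

theorem latNorm_add_le (nrm : Seminorm ℝ (Fin N → ℝ)) (x y : LState N) :
    latNorm nrm (x + y) ≤ latNorm nrm x + latNorm nrm y := by
  refine le_of_eq_of_le ?_ (map_add_le_add nrm _ _)
  simp only [latNorm]
  congr 1
  ext i
  simp

theorem pow_le_one_add_pow {u : ℝ} (hu : 0 ≤ u) {r s : ℕ} (h : r ≤ s) : u ^ r ≤ 1 + u ^ s := by
  rcases le_total u 1 with h1 | h1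
  · linarith [pow_le_one₀ hu h1 (n := r), pow_nonneg hu s]
  · linarith [pow_le_pow_right₀ h1 h]

/-- The weighted `ℓ¹` norm `∑ (1 + |x|^r) |g(x)|`. -/
noncomputable def weightedSum (nrm : Seminorm ℝ (Fin N → ℝ)) (r : ℕ) (g : LState N → ℝ) : ℝ≥0∞ :=
  ∑' x, ENNReal.ofReal ((1 + latNorm nrm x ^ r) * |g x|)

theorem propensity_weight_le (nrm : Seminorm ℝ (Fin N → ℝ)) (ν : LState N) {b : LState N → ℝ}
    (hb : ∀ x, 0 ≤ b x) {s : ℕ} (h : PolyGrowth nrm s b) (r : ℕ) :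
    ∃ D : ℝ, 0 ≤ D ∧ ∀ x, (1 + latNorm nrm (x + ν) ^ r) * b x ≤
      D * (1 + latNorm nrm x ^ (r + s)) := by
  obtain ⟨α, hα, hbα⟩ := h
  set c := latNorm nrm ν
  have hc : 0 ≤ c := latNorm_nonneg _ _
  refine ⟨(1 + 2 ^ r * (1 + c ^ r)) * (3 * α), by positivity, fun x => ?_⟩
  set u := latNorm nrm x
  have hu : 0 ≤ u := latNorm_nonneg _ _
  have h1 : latNorm nrm (x + ν) ^ r ≤ 2 ^ r * (u ^ r + c ^ r) := by
    have := add_pow_le hu hc r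
    refine (pow_le_pow_left₀ (latNorm_nonneg _ _) (latNorm_add_le nrm x ν) r).trans
      (this.trans ?_)
    gcongr
    · norm_num
    · omega
  have h2 : 1 + latNorm nrm (x + ν) ^ r ≤ (1 + 2 ^ r * (1 + c ^ r)) * (1 + u ^ r) := by
    have e1 : 0 ≤ u ^ r := pow_nonneg hu r
    have e2 : 0 ≤ c ^ r := pow_nonneg hc r
    have e3 : (0 : ℝ) < 2 ^ r := by positivity
    nlinarith [mul_nonneg e3.le (mul_nonneg e1 e2)]
  have h3 : b x ≤ α * (u ^ s + 1) := (le_abs_self _).trans (hbα x)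
  -- In the expanded product, each of the mixed terms `u ^ r` and `u ^ s` is at most `1 + u ^ (r +
  -- s)`.
  have h4 : (1 + u ^ r) * (u ^ s + 1) ≤ 3 * (1 + u ^ (r + s)) := by
    have e1 := pow_le_one_add_pow hu (Nat.le_add_right r s)
    have e2 := pow_le_one_add_pow hu (Nat.le_add_left s r)
    have e3 : u ^ (r + s) = u ^ r * u ^ s := pow_add u r s
    nlinarith
  calc (1 + latNorm nrm (x + ν) ^ r) * b x
      ≤ ((1 + 2 ^ r * (1 + c ^ r)) * (1 + u ^ r)) * (α * (u ^ s + 1)) := by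
        gcongr
        exact hb x
    _ = (1 + 2 ^ r * (1 + c ^ r)) * α * ((1 + u ^ r) * (u ^ s + 1)) := by ring
    _ ≤ (1 + 2 ^ r * (1 + c ^ r)) * α * (3 * (1 + u ^ (r + s))) := by gcongr
    _ = _ := by ring

theorem weightedSum_masterOp_le (nrm : Seminorm ℝ (Fin N → ℝ)) (ν : Fin M → LState N)
    {a : Fin M → LState N → ℝ} (ha : ∀ j x, 0 ≤ a j x) {s : ℕ}
    (h : ∀ j, PolyGrowth nrm s (a j)) (r : ℕ) :
    ∃ D : ℝ, 0 ≤ D ∧ ∀ g, weightedSum nrm r (masterOp ν a g) ≤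
      ENNReal.ofReal D * weightedSum nrm (r + s) g := by
  choose D hD0 hD using fun j => propensity_weight_le nrm (ν j) (ha j) (h j) r
  -- `D` serves the inflow terms, shifted by `ν j`; `E`, with shift 0, serves the outflow term.
  choose E hE0 hE using fun j => propensity_weight_le nrm 0 (ha j) (h j) r
  have hw : ∀ (x : LState N) (k : ℕ), 0 ≤ 1 + latNorm nrm x ^ k := fun x k =>
    add_nonneg zero_le_one (pow_nonneg (latNorm_nonneg _ _) _)
  refine ⟨∑ j, (D j + E j), Finset.sum_nonneg fun j _ => add_nonneg (hD0 j) (hE0 j),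
    fun g => ?_⟩
  have hpt : ∀ y, ENNReal.ofReal ((1 + latNorm nrm y ^ r) * |masterOp ν a g y|) ≤
      ∑ j, (ENNReal.ofReal ((1 + latNorm nrm y ^ r) * (a j (y - ν j) * |g (y - ν j)|)) +
        ENNReal.ofReal ((1 + latNorm nrm y ^ r) * (a j y * |g y|))) := by
    intro y
    have hn1 : ∀ j, 0 ≤ (1 + latNorm nrm y ^ r) * (a j (y - ν j) * |g (y - ν j)|) := fun j =>
      mul_nonneg (hw _ _) (mul_nonneg (ha _ _) (abs_nonneg _))
    have hn2 : ∀ j, 0 ≤ (1 + latNorm nrm y ^ r) * (a j y * |g y|) := fun j =>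
      mul_nonneg (hw _ _) (mul_nonneg (ha _ _) (abs_nonneg _))
    simp_rw [← ENNReal.ofReal_add (hn1 _) (hn2 _)]
    rw [← ENNReal.ofReal_sum_of_nonneg fun j _ => add_nonneg (hn1 j) (hn2 j)]
    refine ENNReal.ofReal_le_ofReal ?_
    simp_rw [← mul_add]
    rw [← Finset.mul_sum]
    refine mul_le_mul_of_nonneg_left ?_ (hw _ _)
    rw [Finset.sum_add_distrib, masterOp]
    refine (abs_sub _ _).trans (add_le_add ?_ ?_)
    · refine (Finset.abs_sum_le_sum_abs _ _).trans_eq (Finset.sum_congr rfl fun j _ => ?_)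
      rw [abs_mul, abs_of_nonneg (ha _ _)]
    · rw [totalPropensity, abs_mul, abs_of_nonneg (Finset.sum_nonneg fun j _ => ha j y),
        Finset.sum_mul]
  have hterm : ∀ (F : ℝ) (b : LState N → ℝ) (w : LState N → ℝ),
      0 ≤ F → (∀ x, w x * b x ≤ F * (1 + latNorm nrm x ^ (r + s))) →
      ∑' x, ENNReal.ofReal (w x * (b x * |g x|)) ≤
        ENNReal.ofReal F * weightedSum nrm (r + s) g := by
    intro F b w hF hwb
    rw [weightedSum, ← ENNReal.tsum_mul_left]
    refine ENNReal.tsum_le_tsum fun x => ?_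
    rw [← ENNReal.ofReal_mul hF]
    refine ENNReal.ofReal_le_ofReal ?_
    have := mul_le_mul_of_nonneg_right (hwb x) (abs_nonneg (g x))
    linarith
  refine (ENNReal.tsum_le_tsum hpt).trans ?_
  rw [Summable.tsum_finsetSum fun _ _ => ENNReal.summable,
    ENNReal.ofReal_sum_of_nonneg fun j _ => add_nonneg (hD0 j) (hE0 j), Finset.sum_mul]
  refine Finset.sum_le_sum fun j _ => ?_
  rw [ENNReal.tsum_add, ENNReal.ofReal_add (hD0 j) (hE0 j), add_mul]
  refine add_le_add ?_ ?_
  -- Reindexing by the state before the jump moves the shift from `g` to the weight.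
  · rw [← (Equiv.addRight (ν j)).tsum_eq]
    simp only [Equiv.coe_addRight, add_sub_cancel_right]
    exact hterm (D j) (a j) (fun x => 1 + latNorm nrm (x + ν j) ^ r) (hD0 j) (hD j)
  · exact hterm (E j) (a j) (fun x => 1 + latNorm nrm x ^ r) (hE0 j)
      (by simpa only [add_zero] using hE j)

theorem weightedSum_iterate_masterOp_le (nrm : Seminorm ℝ (Fin N → ℝ)) (ν : Fin M → LState N)
    {a : Fin M → LState N → ℝ} (ha : ∀ j x, 0 ≤ a j x) {s : ℕ}
    (h : ∀ j, PolyGrowth nrm s (a j)) (m r : ℕ) :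
    ∃ (D : ℝ) (k : ℕ), 0 ≤ D ∧ ∀ g, weightedSum nrm r ((masterOp ν a)^[m] g) ≤
      ENNReal.ofReal D * weightedSum nrm k g := by
  induction m generalizing r with
  | zero => exact ⟨1, r, zero_le_one, fun g => by simp⟩
  | succ m ih =>
    obtain ⟨D, hD, hDg⟩ := weightedSum_masterOp_le nrm ν ha h r
    obtain ⟨E, k, hE, hEg⟩ := ih (r + s)
    refine ⟨D * E, k, mul_nonneg hD hE, fun g => ?_⟩
    rw [Function.iterate_succ_apply', ENNReal.ofReal_mul hD, mul_assoc]
    exact (hDg _).trans (by gcongr; exact hEg g)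

/-- The `m`-th derivative is the `m`-fold master operator applied to the row `P(t, x, ·)`; its
`r`-th weighted sum is controlled by a higher moment of that row, of order `k`, which explains the
rate `lam k`. -/
theorem derivBound_transProb {ν : Fin M → LState N} {a : Fin M → LState N → ℝ}
    (ha : ∀ j x, 0 ≤ a j x) (hne : NonExplosive ν a) (nrm : Seminorm ℝ (Fin N → ℝ)) {s : ℕ}
    (h : ∀ j, PolyGrowth nrm s (a j)) {lam : ℕ → ℝ}
    (hP : ∀ r, MomentGrowthBound nrm (transProb ν a) r (lam r) (Ioi 0)) (m r : ℕ) :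
    ∃ (D : ℝ) (k : ℕ), 0 ≤ D ∧ DerivBound nrm (transProb ν a) m r D k (lam k) (Ioi 0) := by
  obtain ⟨D, k, hD, hDg⟩ := weightedSum_iterate_masterOp_le nrm ν ha h m r
  refine ⟨D, k, hD, fun t ht x => ?_⟩
  simp only [timeDeriv]
  simp_rw [iteratedDerivWithin_transProb ha hne m (mem_Ici.2 (le_of_lt ht))]
  refine (hDg _).trans ?_
  rw [mul_assoc, ENNReal.ofReal_mul hD]
  gcongr
  have := hP k t ht x
  rw [add_comm (latNorm nrm x ^ k) 1]
  simpa only [weightedSum, abs_of_nonneg (transProb_nonneg (ν := ν) (a := a) _ _ _)] using this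

/-- The factor 2 is needed because `|x|^s + 1` is not monotone in `s` when `|x| < 1`; it is only at
most twice `|x|^s' + 1`. -/
theorem DerivBound.mono {nrm : Seminorm ℝ (Fin N → ℝ)} {ψ : ℝ → LState N → LState N → ℝ}
    {m r s s' : ℕ} {H H' γ γ' : ℝ} {I : Set ℝ} (h : DerivBound nrm ψ m r H s γ I) (hH : 0 ≤ H)
    (hHH : 2 * H ≤ H') (hs : s ≤ s') (hγ : γ ≤ γ') (hI : ∀ t ∈ I, 0 ≤ t) :
    DerivBound nrm ψ m r H' s' γ' I := by
  intro t ht x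
  refine (h t ht x).trans (ENNReal.ofReal_le_ofReal ?_)
  have h0 := hI t ht
  have hu := latNorm_nonneg nrm x
  have h1 := pow_le_one_add_pow hu hs
  have h2 := pow_nonneg hu s'
  have h3 : H * (latNorm nrm x ^ s + 1) ≤ H' * (latNorm nrm x ^ s' + 1) := by
    calc H * (latNorm nrm x ^ s + 1) ≤ H * (2 * (latNorm nrm x ^ s' + 1)) := by
          gcongr; linarith
      _ = 2 * H * (latNorm nrm x ^ s' + 1) := by ring
      _ ≤ _ := by gcongr
  have h4 : 0 ≤ H' * (latNorm nrm x ^ s' + 1) := by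
    have : 0 ≤ H' := by linarith
    positivity
  exact mul_le_mul h3 (Real.exp_le_exp.2 (mul_le_mul_of_nonneg_right hγ h0))
    (Real.exp_pos _).le h4

end Moments

/-! ### Taylor remainder at time 0 -/

section Taylor

theorem enorm_le_lintegral_derivWithin {F : ℝ → ℝ} (hF : ContDiffOn ℝ 1 F (Ici 0))
    (h0 : F 0 = 0) {t : ℝ} (ht : 0 ≤ t) :
    ‖F t‖ₑ ≤ ∫⁻ u in Ioc 0 t, ‖derivWithin F (Ici 0) u‖ₑ := by
  have hc : ContinuousOn (derivWithin F (Ici 0)) (Ici 0) :=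
    hF.continuousOn_derivWithin (uniqueDiffOn_Ici 0) le_rfl
  have hd : DifferentiableOn ℝ F (Ici 0) := hF.differentiableOn one_ne_zero
  have hint : ∫ u in (0 : ℝ)..t, derivWithin F (Ici 0) u = F t - F 0 := by
    refine intervalIntegral.integral_eq_sub_of_hasDeriv_right_of_le ht
      (hd.continuousOn.mono Icc_subset_Ici_self) (fun u hu => ?_) ?_
    · exact ((hd u hu.1.le).hasDerivWithinAt).mono (Ioi_subset_Ici hu.1.le)
    · refine ContinuousOn.intervalIntegrable (hc.mono ?_)
      rw [uIcc_of_le ht]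
      exact Icc_subset_Ici_self
  rw [h0, sub_zero, intervalIntegral.integral_of_le ht] at hint
  rw [← hint]
  exact enorm_integral_le_lintegral_enorm _

/-- Repeated integration from 0, bounding each of the `q` outer integrals by the length `t` and thus
giving up the factor `1/q!`. The innermost integral is kept, since the derivative is bounded only
after summation over states, not uniformly in each entry. -/
theorem enorm_le_of_iteratedDerivWithin_eq_zero {F : ℝ → ℝ} (q : ℕ)
    (hF : ContDiffOn ℝ ((q + 1 : ℕ) : WithTop ℕ∞) F (Ici 0))
    (h0 : ∀ i ≤ q, iteratedDerivWithin i F (Ici 0) 0 = 0) {t : ℝ} (ht : 0 ≤ t) :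
    ‖F t‖ₑ ≤ ENNReal.ofReal t ^ q *
      ∫⁻ u in Ioc 0 t, ‖iteratedDerivWithin (q + 1) F (Ici 0) u‖ₑ := by
  induction q generalizing F t with
  | zero =>
    simpa [iteratedDerivWithin_one] using enorm_le_lintegral_derivWithin (by simpa using hF)
      (by simpa using h0 0 le_rfl) ht
  | succ q ih =>
    have hF' : ContDiffOn ℝ ((q + 1 : ℕ) : WithTop ℕ∞) (derivWithin F (Ici 0)) (Ici 0) :=
      hF.derivWithin (uniqueDiffOn_Ici 0) (by push_cast; rfl)
    refine (enorm_le_lintegral_derivWithin (hF.of_le (by norm_cast; omega))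
      (by simpa using h0 0 (Nat.zero_le _)) ht).trans ?_
    rw [iteratedDerivWithin_succ']
    set I := ∫⁻ u in Ioc 0 t, ‖iteratedDerivWithin (q + 1) (derivWithin F (Ici 0)) (Ici 0) u‖ₑ
    calc ∫⁻ u in Ioc 0 t, ‖derivWithin F (Ici 0) u‖ₑ
        ≤ ∫⁻ _ in Ioc 0 t, ENNReal.ofReal t ^ q * I := by
          refine setLIntegral_mono' measurableSet_Ioc fun u hu => ?_
          refine (ih hF' (fun i hi => ?_) hu.1.le).trans ?_
          · rw [← iteratedDerivWithin_succ']
            exact h0 (i + 1) (by omega)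
          · refine mul_le_mul' (pow_le_pow_left' (ENNReal.ofReal_le_ofReal hu.2) q) ?_
            exact lintegral_mono_set (Ioc_subset_Ioc_right hu.2)
      _ = ENNReal.ofReal t ^ (q + 1) * I := by
          rw [setLIntegral_const, Real.volume_Ioc, sub_zero]
          ring

end Taylor

/-! ### From derivative bounds to consistency in moment variation -/

section Consistency

variable {N : ℕ} {nrm : Seminorm ℝ (Fin N → ℝ)}

theorem one_add_latNorm_pow_nonneg (nrm : Seminorm ℝ (Fin N → ℝ)) (x : LState N) (r : ℕ) :
    0 ≤ 1 + latNorm nrm x ^ r :=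
  add_nonneg zero_le_one (pow_nonneg (latNorm_nonneg nrm x) r)

theorem weightedSum_sub_le {r : ℕ} {ψ₁ ψ₂ : ℝ → LState N → LState N → ℝ} {q : ℕ}
    (h₁ : ∀ x y, ContDiffOn ℝ ((q + 1 : ℕ) : WithTop ℕ∞) (fun t => ψ₁ t x y) (Ici 0))
    (h₂ : ∀ x y, ContDiffOn ℝ ((q + 1 : ℕ) : WithTop ℕ∞) (fun t => ψ₂ t x y) (Ici 0))
    (h0 : ∀ i ≤ q, ∀ x y, timeDeriv ψ₁ i 0 x y = timeDeriv ψ₂ i 0 x y)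
    {H γ δ : ℝ} {s : ℕ} (hH : 0 ≤ H) (hγ : 0 ≤ γ)
    (hb₁ : DerivBound nrm ψ₁ (q + 1) r H s γ (Ico 0 δ))
    (hb₂ : DerivBound nrm ψ₂ (q + 1) r H s γ (Ioi 0))
    {t : ℝ} (ht : t ∈ Ico 0 δ) (x : LState N) :
    weightedSum nrm r (fun y => ψ₁ t x y - ψ₂ t x y) ≤
      ENNReal.ofReal (2 * H * (latNorm nrm x ^ s + 1) * (t ^ (q + 1) * Real.exp (γ * t))) := by
  have h0t : 0 ≤ t := ht.1
  have hmeas : ∀ (ψ : ℝ → LState N → LState N → ℝ) (y : LState N),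
      ContDiffOn ℝ ((q + 1 : ℕ) : WithTop ℕ∞) (fun t => ψ t x y) (Ici 0) →
      AEMeasurable (fun u => ENNReal.ofReal ((1 + latNorm nrm y ^ r) *
        |timeDeriv ψ (q + 1) u x y|)) (volume.restrict (Ioc 0 t)) := by
    intro ψ y h
    have hc : ContinuousOn (fun u => timeDeriv ψ (q + 1) u x y) (Ioc 0 t) :=
      (h.continuousOn_iteratedDerivWithin le_rfl (uniqueDiffOn_Ici 0)).mono
        (Ioc_subset_Icc_self.trans Icc_subset_Ici_self)
    exact ((continuousOn_const.mul hc.abs).aemeasurable measurableSet_Ioc).ennreal_ofReal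
  have hpt : ∀ y, ENNReal.ofReal ((1 + latNorm nrm y ^ r) * |ψ₁ t x y - ψ₂ t x y|) ≤
      ENNReal.ofReal t ^ q * ∫⁻ u in Ioc 0 t,
        (ENNReal.ofReal ((1 + latNorm nrm y ^ r) * |timeDeriv ψ₁ (q + 1) u x y|) +
          ENNReal.ofReal ((1 + latNorm nrm y ^ r) * |timeDeriv ψ₂ (q + 1) u x y|)) := by
    intro y
    have hsub : ∀ i ≤ q + 1, ∀ u ∈ Ici (0 : ℝ),
        iteratedDerivWithin i ((fun t => ψ₁ t x y) - (fun t => ψ₂ t x y)) (Ici 0) u =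
          timeDeriv ψ₁ i u x y - timeDeriv ψ₂ i u x y := fun i hi u hu =>
      iteratedDerivWithin_sub hu (uniqueDiffOn_Ici 0)
        ((h₁ x y u hu).of_le (by exact_mod_cast hi)) ((h₂ x y u hu).of_le (by exact_mod_cast hi))
    have key := enorm_le_of_iteratedDerivWithin_eq_zero q ((h₁ x y).sub (h₂ x y))
      (fun i hi => by
        rw [← Pi.sub_def, hsub i (by omega) 0 self_mem_Ici, h0 i hi, sub_self]) h0t
    rw [← Pi.sub_def] at key
    have hw := one_add_latNorm_pow_nonneg nrm y r
    rw [ENNReal.ofReal_mul hw, ← Real.enorm_eq_ofReal_abs]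
    refine (mul_le_mul_right key _).trans ?_
    rw [mul_left_comm, ← lintegral_const_mul' _ _ ENNReal.ofReal_ne_top]
    refine mul_le_mul_right (setLIntegral_mono' measurableSet_Ioc fun u hu => ?_) _
    rw [hsub (q + 1) le_rfl u hu.1.le, ENNReal.ofReal_mul hw, ENNReal.ofReal_mul hw, ← mul_add,
      ← Real.enorm_eq_ofReal_abs, ← Real.enorm_eq_ofReal_abs]
    exact mul_le_mul_right enorm_sub_le _
  set B := H * (latNorm nrm x ^ s + 1) * Real.exp (γ * t)
  have hB : ∀ u ∈ Ioc 0 t, ENNReal.ofReal (H * (latNorm nrm x ^ s + 1) * Real.exp (γ * u)) ≤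
      ENNReal.ofReal B := by
    intro u hu
    have := pow_nonneg (latNorm_nonneg nrm x) s
    exact ENNReal.ofReal_le_ofReal (mul_le_mul_of_nonneg_left
      (Real.exp_le_exp.2 (mul_le_mul_of_nonneg_left hu.2 hγ)) (by positivity))
  have hB0 : 0 ≤ B := by
    have := pow_nonneg (latNorm_nonneg nrm x) s
    positivity
  calc weightedSum nrm r (fun y => ψ₁ t x y - ψ₂ t x y)
      ≤ _ := ENNReal.tsum_le_tsum hpt
    -- Tonelli: the sum over target states passes under the time integral. The time 0, where no
    -- bound on `ψ₂` is assumed, lies outside the domain of integration.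
    _ = ENNReal.ofReal t ^ q * ∫⁻ u in Ioc 0 t,
        ((∑' y, ENNReal.ofReal ((1 + latNorm nrm y ^ r) * |timeDeriv ψ₁ (q + 1) u x y|)) +
          ∑' y, ENNReal.ofReal ((1 + latNorm nrm y ^ r) * |timeDeriv ψ₂ (q + 1) u x y|)) := by
        simp_rw [← ENNReal.tsum_add]
        rw [ENNReal.tsum_mul_left, lintegral_tsum fun y =>
          (hmeas ψ₁ y (h₁ x y)).fun_add (hmeas ψ₂ y (h₂ x y))]
    _ ≤ ENNReal.ofReal t ^ q * ∫⁻ _ in Ioc 0 t, (ENNReal.ofReal B + ENNReal.ofReal B) := by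
        refine mul_le_mul_right (setLIntegral_mono' measurableSet_Ioc fun u hu => ?_) _
        exact add_le_add ((hb₁ u ⟨hu.1.le, hu.2.trans_lt ht.2⟩ x).trans (hB u hu))
          ((hb₂ u hu.1 x).trans (hB u hu))
    _ = _ := by
        rw [setLIntegral_const, Real.volume_Ioc, sub_zero, ← ENNReal.ofReal_pow h0t,
          ← ENNReal.ofReal_add hB0 hB0, ← ENNReal.ofReal_mul (by positivity),
          ← ENNReal.ofReal_mul (by positivity)]
        congr 1
        ring

theorem momentVariation_eq (r : ℕ) (g : LState N → ℝ) :
    momentVariation nrm r g = ENNReal.ofReal (1 / 2) * weightedSum nrm r g := by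
  rw [momentVariation, weightedSum, ← ENNReal.tsum_mul_left]
  refine tsum_congr fun x => ?_
  rw [mul_assoc, ENNReal.ofReal_mul (by norm_num)]

/-- By the triangle inequality and an exchange of sums, a weighted `ℓ¹` operator bound follows from
its values on point masses, the rows `ψ x`. It serves both the local error and the moment growth. -/
theorem momentVariation_opApply_le {ψ : LState N → LState N → ℝ} {r k : ℕ} {c : ℝ} (hc : 0 ≤ c)
    (h : ∀ x, weightedSum nrm r (ψ x) ≤ ENNReal.ofReal (c * (1 + latNorm nrm x ^ k)))
    (g : LState N → ℝ) :
    momentVariation nrm r (opApply ψ g) ≤ ENNReal.ofReal c * momentVariation nrm k g := by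
  rw [momentVariation_eq, momentVariation_eq, mul_left_comm]
  refine mul_le_mul_right ?_ _
  have hw := one_add_latNorm_pow_nonneg nrm (N := N)
  calc weightedSum nrm r (opApply ψ g)
      ≤ ∑' y, ∑' x, ENNReal.ofReal |g x| *
          ENNReal.ofReal ((1 + latNorm nrm y ^ r) * |ψ x y|) := by
        refine ENNReal.tsum_le_tsum fun y => ?_
        rw [ENNReal.ofReal_mul (hw y r), ← Real.enorm_eq_ofReal_abs, opApply]
        refine (mul_le_mul_right enorm_tsum_le_tsum_enorm _).trans_eq ?_
        rw [← ENNReal.tsum_mul_left]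
        refine tsum_congr fun x => ?_
        rw [Real.enorm_eq_ofReal_abs, abs_mul, ENNReal.ofReal_mul (abs_nonneg _),
          ENNReal.ofReal_mul (hw y r)]
        ring
    _ = ∑' x, ENNReal.ofReal |g x| * weightedSum nrm r (ψ x) := by
        rw [ENNReal.tsum_comm]
        simp_rw [ENNReal.tsum_mul_left, weightedSum]
    _ ≤ ∑' x, ENNReal.ofReal |g x| * ENNReal.ofReal (c * (1 + latNorm nrm x ^ k)) := by
        gcongr with x
        exact h x
    _ = ENNReal.ofReal c * weightedSum nrm k g := by
        rw [weightedSum, ← ENNReal.tsum_mul_left]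
        refine tsum_congr fun x => ?_
        rw [ENNReal.ofReal_mul hc, ENNReal.ofReal_mul (hw x k)]
        ring

/-- In `4 * H`, one factor 2 comes from adding the bounds on the two derivatives, the other from
replacing `|x|^s + 1` by the weight of order `s + r`. -/
theorem consistentInMoment_of_derivBound {r : ℕ} {ψ₁ ψ₂ : ℝ → LState N → LState N → ℝ} {q : ℕ}
    (h₁ : ∀ x y, ContDiffOn ℝ ((q + 1 : ℕ) : WithTop ℕ∞) (fun t => ψ₁ t x y) (Ici 0))
    (h₂ : ∀ x y, ContDiffOn ℝ ((q + 1 : ℕ) : WithTop ℕ∞) (fun t => ψ₂ t x y) (Ici 0))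
    (h0 : ∀ i ≤ q, ∀ x y, timeDeriv ψ₁ i 0 x y = timeDeriv ψ₂ i 0 x y)
    {H γ δ : ℝ} {s : ℕ} (hH : 0 ≤ H) (hγ : 0 ≤ γ)
    (hb₁ : DerivBound nrm ψ₁ (q + 1) r H s γ (Ico 0 δ))
    (hb₂ : DerivBound nrm ψ₂ (q + 1) r H s γ (Ioi 0)) :
    ConsistentInMoment nrm ψ₁ ψ₂ q r (4 * H) s γ δ := by
  intro t ht g _
  have h0t : 0 ≤ t := ht.1
  have hT : 0 ≤ t ^ (q + 1) * Real.exp (γ * t) := by positivity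
  rw [mul_right_comm, ← ENNReal.ofReal_mul (by positivity)]
  refine momentVariation_opApply_le (by positivity) (fun x => ?_) g
  refine (weightedSum_sub_le h₁ h₂ h0 hH hγ hb₁ hb₂ ht x).trans (ENNReal.ofReal_le_ofReal ?_)
  have hu := latNorm_nonneg nrm x
  have h1 := pow_le_one_add_pow hu (Nat.le_add_right s r)
  have h2 := pow_nonneg hu (s + r)
  calc 2 * H * (latNorm nrm x ^ s + 1) * (t ^ (q + 1) * Real.exp (γ * t))
      ≤ 2 * H * (2 * (1 + latNorm nrm x ^ (s + r))) * (t ^ (q + 1) * Real.exp (γ * t)) := by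
        gcongr
        linarith
    _ = _ := by ring

end Consistency

/-! ### One-step recursion for the marginals of a finite Markov chain -/

section MarkovChains

variable {S Ω : Type*} [MeasurableSpace Ω] {μ : Measure Ω}

/-- The finite-dimensional distribution of a Markov chain with initial weights `p` and
transition kernels `k`. -/
def HasChainLaw {n : ℕ} (μ : Measure Ω) (Z : Fin (n + 1) → Ω → S) (p : S → ℝ≥0∞)
    (k : Fin n → S → S → ℝ≥0∞) : Prop :=
  ∀ x : Fin (n + 1) → S, μ {ω | ∀ i, Z i ω = x i} =
    p (x 0) * ∏ i : Fin n, k i (x i.castSucc) (x i.succ)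

theorem HasChainLaw.measure_snoc {n : ℕ} {Z : Fin (n + 2) → Ω → S} {p : S → ℝ≥0∞}
    {k : Fin (n + 1) → S → S → ℝ≥0∞} (h : HasChainLaw μ Z p k) (x : Fin (n + 1) → S) (y : S) :
    μ ({ω | ∀ i : Fin (n + 1), Z i.castSucc ω = x i} ∩ {ω | Z (Fin.last _) ω = y}) =
      p (x 0) * (∏ i : Fin n, k i.castSucc (x i.castSucc) (x i.succ)) *
        k (Fin.last n) (x (Fin.last n)) y := by
  have hx := h (Fin.snoc (α := fun _ => S) x y)
  rw [Fin.prod_univ_castSucc] at hx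
  simp only [Fin.forall_fin_succ', ← Fin.castSucc_zero (n := n + 1), Fin.snoc_castSucc,
    Fin.succ_castSucc, Fin.succ_last, Fin.snoc_last] at hx
  rw [mul_assoc, ← hx]
  congr 1
  ext ω
  simp only [mem_inter_iff, mem_ofPred_eq]
  rw [Fin.forall_fin_succ']

theorem hasChainLaw_of_real [IsFiniteMeasure μ] {n : ℕ} {Z : Fin (n + 1) → Ω → S} {p₀ : PMF S}
    {K : Fin n → S → S → ℝ} (hK : ∀ i x y, 0 ≤ K i x y)
    (h : ∀ x : Fin (n + 1) → S, μ.real {ω | ∀ i, Z i ω = x i} =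
      (p₀ (x 0)).toReal * ∏ i : Fin n, K i (x i.castSucc) (x i.succ)) :
    HasChainLaw μ Z p₀ fun i x y => ENNReal.ofReal (K i x y) := by
  intro x
  rw [← ofReal_measureReal (measure_ne_top _ _), h, ENNReal.ofReal_mul ENNReal.toReal_nonneg,
    ENNReal.ofReal_toReal (p₀.apply_ne_top _), ENNReal.ofReal_prod_of_nonneg fun i _ => hK _ _ _]

theorem tsum_ofReal_eq_one {K : S → ℝ} (h0 : ∀ y, 0 ≤ K y) (h1 : HasSum K 1) :
    ∑' y, ENNReal.ofReal (K y) = 1 := by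
  rw [← ENNReal.ofReal_tsum_of_nonneg h0 h1.summable, h1.tsum_eq, ENNReal.ofReal_one]

theorem summable_kernel_mul {K : S → S → ℝ} (hK : ∀ x y, 0 ≤ K x y)
    (hK1 : ∀ x, HasSum (K x) 1) {g : S → ℝ} (hg : Summable g) (y : S) :
    Summable fun x => K x y * g x := by
  refine Summable.of_norm_bounded hg.abs fun x => ?_
  rw [norm_mul, Real.norm_of_nonneg (hK x y), Real.norm_eq_abs]
  exact mul_le_of_le_one_left (abs_nonneg _) (le_hasSum (hK1 x) y fun z _ => hK x z)

variable [Countable S] [MeasurableSpace S] [MeasurableSingletonClass S]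

theorem measure_eq_tsum_inter_fiber {f : Ω → S} (hf : Measurable f) (A : Set Ω) :
    μ A = ∑' x, μ (A ∩ {ω | f ω = x}) := by
  have h := tsum_measure_preimage_singleton (μ := μ.restrict A) (Set.countable_univ (α := S))
    (f := f) fun y _ => hf (measurableSet_singleton y)
  rw [tsum_univ (fun x => μ.restrict A (f ⁻¹' {x})), preimage_univ,
    Measure.restrict_apply_univ] at h
  rw [← h]
  refine tsum_congr fun x => ?_
  rw [Measure.restrict_apply (hf (measurableSet_singleton x)), inter_comm]
  rfl

/-- Summing over the last coordinate removes the last kernel, whose rows have total mass 1. This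
lets the inductions below shorten the chain from its end. -/
theorem HasChainLaw.init {n : ℕ} {Z : Fin (n + 2) → Ω → S} {p : S → ℝ≥0∞}
    {k : Fin (n + 1) → S → S → ℝ≥0∞} (h : HasChainLaw μ Z p k) (hZ : ∀ i, Measurable (Z i))
    (hk : ∀ i x, ∑' y, k i x y = 1) :
    HasChainLaw μ (fun i : Fin (n + 1) => Z i.castSucc) p fun i => k i.castSucc := by
  intro x
  rw [measure_eq_tsum_inter_fiber (hZ (Fin.last _))]
  simp_rw [h.measure_snoc]
  rw [ENNReal.tsum_mul_left, hk, mul_one]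

theorem HasChainLaw.measure_zero {n : ℕ} {Z : Fin (n + 1) → Ω → S} {p : S → ℝ≥0∞}
    {k : Fin n → S → S → ℝ≥0∞} (h : HasChainLaw μ Z p k) (hZ : ∀ i, Measurable (Z i))
    (hk : ∀ i x, ∑' y, k i x y = 1) (y : S) : μ {ω | Z 0 ω = y} = p y := by
  induction n with
  | zero => simpa using h fun _ => y
  | succ n ih => simpa using ih (h.init hZ hk) (fun i => hZ _) fun i => hk _

/-- Both sides are decomposed over the countably many complete histories before the last step; the
joint law makes them agree history by history. -/
theorem HasChainLaw.measure_last {n : ℕ} {Z : Fin (n + 2) → Ω → S} {p : S → ℝ≥0∞}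
    {k : Fin (n + 1) → S → S → ℝ≥0∞} (h : HasChainLaw μ Z p k) (hZ : ∀ i, Measurable (Z i))
    (hk : ∀ i x, ∑' y, k i x y = 1) (y : S) :
    μ {ω | Z (Fin.last _) ω = y} =
      ∑' z, k (Fin.last n) z y * μ {ω | Z (Fin.last n).castSucc ω = z} := by
  have hpre : Measurable fun ω (i : Fin (n + 1)) => Z i.castSucc ω :=
    measurable_pi_lambda _ fun i => hZ _
  have hset : ∀ x : Fin (n + 1) → S,
      {ω | (fun i : Fin (n + 1) => Z i.castSucc ω) = x} =
        {ω | ∀ i : Fin (n + 1), Z i.castSucc ω = x i} := fun x => by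
    ext ω
    exact funext_iff
  rw [measure_eq_tsum_inter_fiber hpre]
  have hl : ∀ x, μ ({ω | Z (Fin.last _) ω = y} ∩
      {ω | (fun i : Fin (n + 1) => Z i.castSucc ω) = x}) =
      μ {ω | ∀ i : Fin (n + 1), Z i.castSucc ω = x i} * k (Fin.last n) (x (Fin.last n)) y := by
    intro x
    rw [hset, inter_comm, h.measure_snoc, h.init hZ hk x]
  have hr : ∀ z, k (Fin.last n) z y * μ {ω | Z (Fin.last n).castSucc ω = z} =
      ∑' x : Fin (n + 1) → S, k (Fin.last n) z y * μ ({ω | Z (Fin.last n).castSucc ω = z} ∩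
        {ω | (fun i : Fin (n + 1) => Z i.castSucc ω) = x}) := by
    intro z
    rw [ENNReal.tsum_mul_left, ← measure_eq_tsum_inter_fiber hpre]
  simp_rw [hl, hr]
  rw [ENNReal.tsum_comm]
  refine tsum_congr fun x => ?_
  -- A history `x` fixes the state before the last step, so only that value of `z` contributes.
  rw [tsum_eq_single (x (Fin.last n))]
  · have hsub : {ω | ∀ i : Fin (n + 1), Z i.castSucc ω = x i} ⊆
        {ω | Z (Fin.last n).castSucc ω = x (Fin.last n)} :=
      ofPred_subset_ofPred.2 fun ω hω => hω (Fin.last n)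
    rw [mul_comm, hset, inter_eq_self_of_subset_right hsub]
  · intro z hz
    rw [hset, (_ : _ ∩ _ = (∅ : Set Ω)), measure_empty, mul_zero]
    ext ω
    simp only [mem_inter_iff, mem_ofPred_eq, mem_empty_iff_false, iff_false]
    exact fun hω => hz (hω.1.symm.trans (hω.2 _))

theorem HasChainLaw.measure_succ {n : ℕ} {Z : Fin (n + 1) → Ω → S} {p : S → ℝ≥0∞}
    {k : Fin n → S → S → ℝ≥0∞} (h : HasChainLaw μ Z p k) (hZ : ∀ i, Measurable (Z i))
    (hk : ∀ i x, ∑' y, k i x y = 1) (i : Fin n) (y : S) :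
    μ {ω | Z i.succ ω = y} = ∑' z, k i z y * μ {ω | Z i.castSucc ω = z} := by
  induction n with
  | zero => exact i.elim0
  | succ n ih =>
    refine Fin.lastCases ?_ (fun j => ?_) i
    · exact h.measure_last hZ hk y
    · exact ih (h.init hZ hk) (fun i => hZ _) (fun i => hk _) j

theorem summable_measureReal_fiber [IsFiniteMeasure μ] {f : Ω → S} (hf : Measurable f) :
    Summable fun x => μ.real {ω | f ω = x} := by
  refine ENNReal.summable_toReal ?_
  have := measure_eq_tsum_inter_fiber (μ := μ) hf univ
  simp only [univ_inter] at this
  rw [← this]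
  exact measure_ne_top _ _

theorem measureReal_zero_of_chain [IsFiniteMeasure μ] {n : ℕ} {Z : Fin (n + 1) → Ω → S}
    {p₀ : PMF S} {K : Fin n → S → S → ℝ} (hZ : ∀ i, Measurable (Z i))
    (hK : ∀ i x y, 0 ≤ K i x y) (hK1 : ∀ i x, HasSum (K i x) 1)
    (h : ∀ x : Fin (n + 1) → S, μ.real {ω | ∀ i, Z i ω = x i} =
      (p₀ (x 0)).toReal * ∏ i : Fin n, K i (x i.castSucc) (x i.succ)) (y : S) :
    μ.real {ω | Z 0 ω = y} = (p₀ y).toReal := by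
  rw [measureReal_def, (hasChainLaw_of_real hK h).measure_zero hZ
    fun i x => tsum_ofReal_eq_one (hK i x) (hK1 i x)]

theorem measureReal_succ_of_chain [IsFiniteMeasure μ] {n : ℕ} {Z : Fin (n + 1) → Ω → S}
    {p₀ : PMF S} {K : Fin n → S → S → ℝ} (hZ : ∀ i, Measurable (Z i))
    (hK : ∀ i x y, 0 ≤ K i x y) (hK1 : ∀ i x, HasSum (K i x) 1)
    (h : ∀ x : Fin (n + 1) → S, μ.real {ω | ∀ i, Z i ω = x i} =
      (p₀ (x 0)).toReal * ∏ i : Fin n, K i (x i.castSucc) (x i.succ)) (i : Fin n) (y : S) :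
    μ.real {ω | Z i.succ ω = y} = ∑' x, K i x y * μ.real {ω | Z i.castSucc ω = x} := by
  rw [measureReal_def, (hasChainLaw_of_real hK h).measure_succ hZ
    fun i x => tsum_ofReal_eq_one (hK i x) (hK1 i x), ENNReal.tsum_toReal_eq
    fun x => ENNReal.mul_ne_top ENNReal.ofReal_ne_top (measure_ne_top _ _)]
  refine tsum_congr fun x => ?_
  rw [ENNReal.toReal_mul, ENNReal.toReal_ofReal (hK _ _ _), measureReal_def]

end MarkovChains

/-! ### Accumulation of the local errors along the mesh -/

section Convergence

variable {N M : ℕ} {nrm : Seminorm ℝ (Fin N → ℝ)}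

theorem hasSum_transProb {ν : Fin M → LState N} {a : Fin M → LState N → ℝ}
    (hne : NonExplosive ν a) {t : ℝ} (ht : 0 ≤ t) (x : LState N) :
    HasSum (transProb ν a t x) 1 := by
  have h1 : ∑' y, transProbENN ν a t x y ≠ ∞ := by
    rw [hne t ht x]
    exact ENNReal.one_ne_top
  have h := ENNReal.hasSum_toReal h1
  rw [← ENNReal.tsum_toReal_eq (ENNReal.ne_top_of_tsum_ne_top h1), hne t ht x,
    ENNReal.toReal_one] at h
  exact h

theorem momentVariation_add_le (r : ℕ) (f g : LState N → ℝ) :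
    momentVariation nrm r (fun x => f x + g x) ≤
      momentVariation nrm r f + momentVariation nrm r g := by
  have hw : ∀ x, 0 ≤ 1 / 2 * (1 + latNorm nrm x ^ r) := fun x =>
    mul_nonneg (by norm_num) (one_add_latNorm_pow_nonneg nrm x r)
  rw [momentVariation, momentVariation, momentVariation, ← ENNReal.tsum_add]
  refine ENNReal.tsum_le_tsum fun x => ?_
  rw [← ENNReal.ofReal_add (mul_nonneg (hw x) (abs_nonneg _)) (mul_nonneg (hw x) (abs_nonneg _)),
    ← mul_add]
  exact ENNReal.ofReal_le_ofReal (mul_le_mul_of_nonneg_left (abs_add_le _ _) (hw x))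

theorem MomentGrowthBound.momentVariation_opApply_le {ψ : ℝ → LState N → LState N → ℝ} {r : ℕ}
    {ℓ : ℝ} {I : Set ℝ} (h : MomentGrowthBound nrm ψ r ℓ I) {t : ℝ} (ht : t ∈ I)
    (h0 : ∀ x y, 0 ≤ ψ t x y) (g : LState N → ℝ) :
    momentVariation nrm r (opApply (ψ t) g) ≤
      ENNReal.ofReal (Real.exp (ℓ * t)) * momentVariation nrm r g := by
  refine _root_.momentVariation_opApply_le (Real.exp_pos _).le (fun x => ?_) g
  rw [mul_comm (Real.exp _)]
  simpa only [weightedSum, abs_of_nonneg (h0 _ _)] using h t ht x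

theorem step_le_maxStep {n : ℕ} (t : Fin (n + 1) → ℝ) (i : Fin n) :
    t i.succ - t i.castSucc ≤ maxStep t :=
  le_ciSup (f := fun j : Fin n => t j.succ - t j.castSucc) (Set.finite_range _).bddAbove i

theorem IsMesh.nonneg {n : ℕ} {T : ℝ} {t : Fin (n + 1) → ℝ} (h : IsMesh T t) (i : Fin (n + 1)) :
    0 ≤ t i :=
  h.1.symm.le.trans (h.2.1.monotone (Fin.zero_le i))

theorem IsMesh.le {n : ℕ} {T : ℝ} {t : Fin (n + 1) → ℝ} (h : IsMesh T t) (i : Fin (n + 1)) :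
    t i ≤ T :=
  (h.2.1.monotone (Fin.le_last i)).trans h.2.2.le

theorem IsMesh.step_pos {n : ℕ} {T : ℝ} {t : Fin (n + 1) → ℝ} (h : IsMesh T t) (i : Fin n) :
    0 < t i.succ - t i.castSucc :=
  sub_pos.2 (h.2.1 i.castSucc_lt_succ)

theorem maxStep_nonneg {n : ℕ} {T : ℝ} {t : Fin (n + 1) → ℝ} (h : IsMesh T t) :
    0 ≤ maxStep t :=
  Real.iSup_nonneg fun j => (h.step_pos j).le

/-- Growth of moments along a chain of operators. -/
theorem momentVariation_chain_le {P : ℝ → LState N → LState N → ℝ}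
    (hP : ∀ t, 0 ≤ t → ∀ x y, 0 ≤ P t x y) {r : ℕ} {ℓ : ℝ}
    (hg : MomentGrowthBound nrm P r ℓ (Ioi 0)) {n : ℕ} {T : ℝ} {t : Fin (n + 1) → ℝ}
    (ht : IsMesh T t) {p : Fin (n + 1) → LState N → ℝ}
    (hp : ∀ i : Fin n, p i.succ = opApply (P (t i.succ - t i.castSucc)) (p i.castSucc))
    (i : Fin (n + 1)) :
    momentVariation nrm r (p i) ≤
      ENNReal.ofReal (Real.exp (ℓ * t i)) * momentVariation nrm r (p 0) := by
  induction i using Fin.induction with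
  | zero => simp [ht.1]
  | succ i ih =>
    rw [hp i]
    refine (hg.momentVariation_opApply_le (ht.step_pos i) (hP _ (ht.step_pos i).le) _).trans
      ((mul_le_mul_right ih _).trans_eq ?_)
    rw [← mul_assoc, ← ENNReal.ofReal_mul (Real.exp_pos _).le, ← Real.exp_add]
    congr 3
    ring

/-- The induction step in scalar form: once all rates are replaced by their maximum `m`, both terms
carry `e^{m(t+h)}`, and `h^{q+1} ≤ h τ^q` makes the prefactors add up to `t + h`. -/
theorem exp_step_le {l l' γ h t τ : ℝ} (q : ℕ) (hh : 0 ≤ h) (ht : 0 ≤ t) (hτ : h ≤ τ) :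
    Real.exp (l * h) * (t * Real.exp (max l (max l' γ) * t) * τ ^ q) +
        Real.exp (l' * t) * (h ^ (q + 1) * Real.exp (γ * h)) ≤
      (t + h) * Real.exp (max l (max l' γ) * (t + h)) * τ ^ q := by
  set m := max l (max l' γ)
  have h1 : l ≤ m := le_max_left _ _
  have h2 : l' ≤ m := (le_max_left _ _).trans (le_max_right _ _)
  have h3 : γ ≤ m := (le_max_right _ _).trans (le_max_right _ _)
  have hτ0 : 0 ≤ τ := hh.trans hτ
  calc _ ≤ Real.exp (m * h) * (t * Real.exp (m * t) * τ ^ q) +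
        Real.exp (m * t) * (h * τ ^ q * Real.exp (m * h)) := by
        rw [pow_succ' h q]
        gcongr
    _ = _ := by
        rw [mul_add m, Real.exp_add]
        ring

/-- The one-step consistency estimate accumulates to the global error estimate. -/
theorem momentVariation_error_le {φ P : ℝ → LState N → LState N → ℝ}
    (hφ : ∀ t, 0 ≤ t → ∀ x y, 0 ≤ φ t x y) (hP : ∀ t, 0 ≤ t → ∀ x y, 0 ≤ P t x y)
    (hφ1 : ∀ t, 0 ≤ t → ∀ x, HasSum (φ t x) 1) (hP1 : ∀ t, 0 ≤ t → ∀ x, HasSum (P t x) 1)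
    {lam : ℕ → ℝ} {q r s : ℕ} {C γ δ : ℝ}
    (hgφ : MomentGrowthBound nrm φ r (lam r) (Ico 0 δ))
    (hgP : ∀ k, MomentGrowthBound nrm P k (lam k) (Ioi 0))
    (hcons : ConsistentInMoment nrm φ P q r C s γ δ)
    {n : ℕ} {T : ℝ} {t : Fin (n + 1) → ℝ} (ht : IsMesh T t) (hδ : maxStep t < δ)
    {p p' : Fin (n + 1) → LState N → ℝ} (hsum : ∀ i, Summable (p i)) (hsum' : ∀ i, Summable (p' i))
    (h0 : p' 0 = p 0) (hfin : FiniteMoments nrm (p 0))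
    (hp : ∀ i : Fin n, p i.succ = opApply (P (t i.succ - t i.castSucc)) (p i.castSucc))
    (hp' : ∀ i : Fin n, p' i.succ = opApply (φ (t i.succ - t i.castSucc)) (p' i.castSucc))
    (i : Fin (n + 1)) :
    momentVariation nrm r (fun x => p' i x - p i x) ≤
      ENNReal.ofReal C * momentVariation nrm (s + r) (p 0) *
        ENNReal.ofReal (t i * Real.exp (max (lam r) (max (lam (s + r)) γ) * t i) *
          maxStep t ^ q) := by
  induction i using Fin.induction with
  | zero => simp [h0, momentVariation]
  | succ i ih =>
    set h := t i.succ - t i.castSucc with hh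
    have hpos : 0 ≤ h := (ht.step_pos i).le
    have hle : h ≤ maxStep t := step_le_maxStep t i
    have hI : h ∈ Ico 0 δ := ⟨hpos, hle.trans_lt hδ⟩
    -- Propagated error plus local error. The method acts on the old error and the difference of
    -- kernels on the exact law, so consistency is needed only for the latter.
    have hdec : (fun x => p' i.succ x - p i.succ x) = fun y =>
        opApply (φ h) (fun x => p' i.castSucc x - p i.castSucc x) y +
          opApply (fun x x' => φ h x x' - P h x x') (p i.castSucc) y := by
      ext y
      have e1 := summable_kernel_mul (hφ h hpos) (hφ1 h hpos) (hsum' i.castSucc) y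
      have e2 := summable_kernel_mul (hφ h hpos) (hφ1 h hpos) (hsum i.castSucc) y
      have e3 := summable_kernel_mul (hP h hpos) (hP1 h hpos) (hsum i.castSucc) y
      rw [hp, hp']
      simp only [opApply, mul_sub, sub_mul]
      rw [e1.tsum_sub e2, e2.tsum_sub e3]
      ring
    -- Consistency applies only to functions with all moments finite; the exact dynamics preserves
    -- this class, thanks to moment growth of every order `k`.
    have hfin' : FiniteMoments nrm (p i.castSucc) := fun k =>
      (momentVariation_chain_le hP (hgP k) ht hp i.castSucc).trans_lt
        (ENNReal.mul_lt_top ENNReal.ofReal_lt_top (hfin k))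
    rw [hdec]
    refine (momentVariation_add_le r _ _).trans ?_
    refine (add_le_add
      ((hgφ.momentVariation_opApply_le hI (hφ h hpos) _).trans (mul_le_mul_right ih _))
      ((hcons h hI _ hfin').trans (mul_le_mul_left (mul_le_mul_right
        (momentVariation_chain_le hP (hgP (s + r)) ht hp i.castSucc) _) _))).trans ?_
    set A := momentVariation nrm (s + r) (p 0)
    have ht0 := ht.nonneg i.castSucc
    have hm := maxStep_nonneg ht
    have hsucc : t i.succ = t i.castSucc + h := by rw [hh]; ring
    rw [hsucc]
    refine le_trans (le_of_eq ?_) (mul_le_mul_right (ENNReal.ofReal_le_ofReal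
      (exp_step_le (l := lam r) (l' := lam (s + r)) (γ := γ) q hpos ht0 hle)) _)
    rw [ENNReal.ofReal_add (by positivity) (by positivity),
      ENNReal.ofReal_mul (Real.exp_pos _).le, ENNReal.ofReal_mul (Real.exp_pos _).le]
    ring

end Convergence


/-! ### Assembly of the main theorem -/

theorem mainTheorem1 {N M : ℕ}
    -- the chemical process
    (ν : Fin M → LState N) (a : Fin M → LState N → ℝ)
    (ha : ∀ j x, 0 ≤ a j x) (hne : NonExplosive ν a)
    -- the tau leap method
    (φ : ℝ → LState N → LState N → ℝ) (hφ : IsTauLeapMethod φ)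
    -- the common norm on `ℝ^N`
    (nrm : Seminorm ℝ (Fin N → ℝ)) (hnrm : ∀ v, nrm v = 0 → v = 0)
    (q : ℕ) (lam H γ δ : ℕ → ℝ) (s : ℕ → ℕ)
    -- the propensities are polynomially bounded
    (h_prop : ∃ s' : ℕ, ∀ j, PolyGrowth nrm s' (a j))
    -- exponential moment growth bound for the process
    (h_P : ∀ r, 0 < lam r ∧ MomentGrowthBound nrm (transProb ν a) r (lam r) (Ioi 0))
    -- pointwise consistency of order `q`
    (h_cons : PointwiseConsistent φ (transProb ν a) q)
    -- derivative bounds on `φ` (for `r = 0`, this is the bound in total variation)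
    (h_deriv : ∀ r, 0 < H r ∧ 0 < s r ∧ 0 < δ r ∧ 0 < γ r ∧
      DerivBound nrm φ (q + 1) r (H r) (s r) (γ r) (Ico 0 (δ r)))
    -- exponential moment growth bound for `φ`
    (h_φ : ∀ r, MomentGrowthBound nrm φ r (lam r) (Ico 0 (δ r)))
    (r : ℕ) :
    -- the constants can be enlarged so that the derivative bound also holds for `P`
    (∃ (Hr : ℝ) (sr : ℕ) (γr : ℝ), H r ≤ Hr ∧ s r ≤ sr ∧ γ r ≤ γr ∧
      DerivBound nrm φ (q + 1) r Hr sr γr (Ico 0 (δ r)) ∧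
      DerivBound nrm (transProb ν a) (q + 1) r Hr sr γr (Ioi 0)) ∧
    -- for all constants with which both derivative bounds hold:
    ∀ (Hr : ℝ) (sr : ℕ) (γr : ℝ), 0 < Hr → 0 < sr → 0 < γr →
      DerivBound nrm φ (q + 1) r Hr sr γr (Ico 0 (δ r)) →
      DerivBound nrm (transProb ν a) (q + 1) r Hr sr γr (Ioi 0) →
      -- there is a consistency constant, and the convergence estimate holds with each such constant
      (∃ C, 0 < C ∧ ConsistentInMoment nrm φ (transProb ν a) q r C sr γr (δ r)) ∧
      ∀ C, 0 < C → ConsistentInMoment nrm φ (transProb ν a) q r C sr γr (δ r) →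
        ∀ (p₀ : PMF (LState N)), FiniteMoments nrm (fun x => (p₀ x).toReal) →
        ∀ (T : ℝ) (n : ℕ) (t : Fin (n + 1) → ℝ), IsMesh T t → maxStep t < δ r →
        ∀ (Ω : Type*) [MeasurableSpace Ω] (ℙ : Measure Ω) [IsProbabilityMeasure ℙ]
          (X : ℝ → Ω → LState N), IsChemicalProcess ν a p₀ ℙ X →
        ∀ (Ω' : Type*) [MeasurableSpace Ω'] (ℙ' : Measure Ω') [IsProbabilityMeasure ℙ']
          (Y : ℝ → Ω' → LState N), IsTauLeapSolution φ p₀ t ℙ' Y →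
        ∀ i : Fin (n + 1),
          momentVariation nrm r
              (fun x => ℙ'.real {ω | Y (t i) ω = x} - ℙ.real {ω | X (t i) ω = x}) ≤
            ENNReal.ofReal C * momentVariation nrm (sr + r) (fun x => (p₀ x).toReal) *
              ENNReal.ofReal (t i * Real.exp (max (lam r) (max (lam (sr + r)) γr) * t i) *
                maxStep t ^ q) ∧
          ENNReal.ofReal C * momentVariation nrm (sr + r) (fun x => (p₀ x).toReal) *
              ENNReal.ofReal (t i * Real.exp (max (lam r) (max (lam (sr + r)) γr) * t i) *
                maxStep t ^ q) ≤
            ENNReal.ofReal C * momentVariation nrm (sr + r) (fun x => (p₀ x).toReal) *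
              ENNReal.ofReal (T * Real.exp (max (lam r) (max (lam (sr + r)) γr) * T) *
                maxStep t ^ q) := by
  obtain ⟨s', hs'⟩ := h_prop
  have hgP := fun k => (h_P k).2
  have hφC := fun x y => (h_cons x y).1
  have hPC := contDiffOn_transProb ha hne (q + 1)
  -- The consistency assumption starts at order 1; order 0 holds because both kernels are the
  -- identity at time 0.
  have h0 : ∀ i ≤ q, ∀ x y, timeDeriv φ i 0 x y = timeDeriv (transProb ν a) i 0 x y := by
    intro i hi x y
    rcases Nat.eq_zero_or_pos i with rfl | hi'
    · simp only [timeDeriv, iteratedDerivWithin_zero]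
      rw [hφ.zero_step, transProb_zero]
    · exact (h_cons x y).2 i (Finset.mem_Icc.2 ⟨hi', hi⟩)
  refine ⟨?_, fun Hr sr γr hHr _ hγr hbφ hbP => ⟨?_, ?_⟩⟩
  · obtain ⟨D, k, hD, hDb⟩ := derivBound_transProb ha hne nrm hs' hgP (q + 1) r
    obtain ⟨hH, _, _, _, hb⟩ := h_deriv r
    -- The sum dominates both `2 * H r` and `2 * D`, as `DerivBound.mono` requires for the two
    -- kernels.
    refine ⟨2 * H r + 2 * D, max (s r) k, max (γ r) (lam k), by linarith, le_max_left _ _,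
      le_max_left _ _, ?_, ?_⟩
    · exact hb.mono hH.le (by linarith) (le_max_left _ _) (le_max_left _ _) fun t ht => ht.1
    · exact hDb.mono hD (by linarith) (le_max_right _ _) (le_max_right _ _)
        fun t ht => le_of_lt ht
  · exact ⟨4 * Hr, by positivity,
      consistentInMoment_of_derivBound hφC hPC h0 hHr.le hγr.le hbφ hbP⟩
  · intro C _ hcons p₀ hp₀ T n t ht hδ Ω _ ℙ _ X hX Ω' _ ℙ' _ Y hY i
    have hP0 : ∀ t, 0 ≤ t → ∀ x y, 0 ≤ transProb ν a t x y := fun t _ x y =>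
      transProb_nonneg t x y
    have hXm : ∀ i, Measurable (X (t i)) := fun i => hX.measurable _ (ht.nonneg i)
    have hYm : ∀ i, Measurable (Y (t i)) := fun i =>
      hY.measurable _ ⟨ht.nonneg i, ht.2.1.monotone (Fin.le_last i)⟩
    have hXM := hX.markov n t ht.1 ht.2.1
    have hP1 := fun t ht x => hasSum_transProb hne (t := t) ht x
    have hX0 : (fun x => ℙ.real {ω | X (t 0) ω = x}) = fun x => (p₀ x).toReal :=
      funext (measureReal_zero_of_chain hXm (fun i => hP0 _ (ht.step_pos i).le)
        (fun i => hP1 _ (ht.step_pos i).le) hXM)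
    have hY0 : (fun x => ℙ'.real {ω | Y (t 0) ω = x}) = fun x => (p₀ x).toReal :=
      funext (measureReal_zero_of_chain hYm (fun i => hφ.nonneg _ (ht.step_pos i).le)
        (fun i => hφ.sum_eq_one _ (ht.step_pos i).le) hY.markov)
    constructor
    · rw [← hX0]
      refine momentVariation_error_le (p := fun i x => ℙ.real {ω | X (t i) ω = x})
        (p' := fun i x => ℙ'.real {ω | Y (t i) ω = x}) hφ.nonneg hP0 hφ.sum_eq_one hP1 (h_φ r)
        hgP hcons ht hδ (fun i => summable_measureReal_fiber (hXm i))
        (fun i => summable_measureReal_fiber (hYm i)) (hY0.trans hX0.symm)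
        (hX0 ▸ hp₀) (fun i => ?_) (fun i => ?_) i
      · exact funext (measureReal_succ_of_chain hXm (fun i => hP0 _ (ht.step_pos i).le)
          (fun i => hP1 _ (ht.step_pos i).le) hXM i)
      · exact funext (measureReal_succ_of_chain hYm (fun i => hφ.nonneg _ (ht.step_pos i).le)
          (fun i => hφ.sum_eq_one _ (ht.step_pos i).le) hY.markov i)
    · have hm := maxStep_nonneg ht
      have hti := ht.nonneg i
      have hle := ht.le i
      have hT : 0 ≤ T := hti.trans hle
      -- The rate must be nonnegative for the exponential to increase from `t i` to `T`.
      have hmax : 0 ≤ max (lam r) (max (lam (sr + r)) γr) := (h_P r).1.le.trans (le_max_left _ _)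
      gcongr
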